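/- Let $K$ be an algebraically closed field, let $k \ge 0$, and for $1 \le i \le k$ let $0 \le d_i \le m_i$ be integers and let $G_i = \mathrm{Gr}(d_i, K^{m_i})$ be the Grassmannian of $d_i$-dimensional linear subspaces of $K^{m_i}$, embedded in $\mathbb{P}^{N_i}$ with $N_i = \binom{m_i}{d_i} - 1$ by the Plücker embedding. Equip $G = G_1 \times \cdots \times G_k \subseteq \mathbb{P}^{N_1} \times \cdots \times \mathbb{P}^{N_k}$ with the Zariski topology, whose closed sets are the common zero sets in $G$ of sets of multihomogeneous polynomials in the Plücker coordinates. Let $Z \subseteq G$ be a hypersurface, that is, a closed subset all of whose irreducible components have codimension $1$ in $G$. Then there is a single multihomogeneous form $F$ over $K$ in the $k$ groups of Plücker coordinates (homogeneous of some degree $D_i \geq 0$ in the $i$-th group, for each $i$) such that $Z = Z(F)$, the set of points of $G$ at which $F$ vanishes. -/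

import Mathlib

open scoped LinearAlgebra.Projectivization

namespace MultiPlucker

/-! ### The Zariski topology on a product of projective spaces -/

/-- The product `∏ i, ℙ(K^{σ i})` of the projective spaces with homogeneous coordinates indexed by
`σ i`, `i : Fin k`. -/
def MultiProj (K : Type*) [Field K] {k : ℕ} (σ : Fin k → Type*) : Type _ :=
  (i : Fin k) → ℙ K (σ i → K)

/-- `F` is multihomogeneous of multidegree `D`: in every monomial of `F`, the total degree in the
`i`-th group of variables is `D i`. -/
def IsMultihomogeneousOfDegree {K : Type*} [Field K] {k : ℕ} {σ : Fin k → Type*}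
    (F : MvPolynomial (Σ i, σ i) K) (D : Fin k → ℕ) : Prop :=
  F.IsWeightedHomogeneous (fun s : Σ i, σ i => (Pi.single s.1 1 : Fin k → ℕ)) D

/-- `F` is a multihomogeneous form, of some multidegree. -/
def IsMultihomogeneous {K : Type*} [Field K] {k : ℕ} {σ : Fin k → Type*}
    (F : MvPolynomial (Σ i, σ i) K) : Prop :=
  ∃ D : Fin k → ℕ, IsMultihomogeneousOfDegree F D

/-- The polynomial `F` vanishes at the point `p`, tested on one choice of homogeneous coordinates
of `p`. For multihomogeneous `F` the choice is irrelevant, see `vanishesAt_iff`. -/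
def VanishesAt {K : Type*} [Field K] {k : ℕ} {σ : Fin k → Type*}
    (F : MvPolynomial (Σ i, σ i) K) (p : MultiProj K σ) : Prop :=
  MvPolynomial.eval (fun s : Σ i, σ i => (p s.1).rep s.2) F = 0

theorem eval_smul {K : Type*} [Field K] {k : ℕ} {σ : Fin k → Type*}
    {F : MvPolynomial (Σ i, σ i) K} {D : Fin k → ℕ} (hF : IsMultihomogeneousOfDegree F D)
    (c : Fin k → K) (x : (Σ i, σ i) → K) :
    MvPolynomial.eval (fun s => c s.1 * x s) F = (∏ i, c i ^ D i) * MvPolynomial.eval x F := by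
  rw [MvPolynomial.eval_eq, MvPolynomial.eval_eq, Finset.mul_sum]
  refine Finset.sum_congr rfl fun e he => ?_
  have h := hF (MvPolynomial.mem_support_iff.mp he)
  have h2 : ∏ s ∈ e.support, c s.1 ^ e s = ∏ i, c i ^ D i := by
    rw [← h, Finsupp.weight_apply, Finsupp.sum]
    simp only [Finset.sum_apply, Pi.smul_apply, smul_eq_mul]
    simp_rw [← Finset.prod_pow_eq_pow_sum]
    rw [Finset.prod_comm]
    refine Finset.prod_congr rfl fun s _ => ?_
    rw [Finset.prod_eq_single s.1]
    · simp
    · intro j _ hj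
      simp [hj]
    · simp
  simp_rw [mul_pow, Finset.prod_mul_distrib, h2]
  ring

/-- The vanishing of a multihomogeneous form at a point can be tested on arbitrary homogeneous
coordinates of the point. -/
theorem vanishesAt_iff {K : Type*} [Field K] {k : ℕ} {σ : Fin k → Type*}
    {F : MvPolynomial (Σ i, σ i) K} (hF : IsMultihomogeneous F)
    (v : (i : Fin k) → σ i → K) (hv : ∀ i, v i ≠ 0) :
    VanishesAt F (fun i => Projectivization.mk K (v i) (hv i)) ↔
      MvPolynomial.eval (fun s : Σ i, σ i => v s.1 s.2) F = 0 := by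
  obtain ⟨D, hD⟩ := hF
  choose a ha using fun i => Projectivization.exists_smul_eq_mk_rep K (v i) (hv i)
  have h : (fun s : Σ i, σ i => (Projectivization.mk K (v s.1) (hv s.1)).rep s.2) =
      fun s : Σ i, σ i => (a s.1 : K) * v s.1 s.2 := by
    funext s
    rw [← ha s.1]
    rfl
  unfold VanishesAt
  rw [h, eval_smul hD (fun i => (a i : K)) (fun s => v s.1 s.2), mul_eq_zero, or_iff_right]
  exact Finset.prod_ne_zero_iff.mpr fun i _ => pow_ne_zero _ (a i).ne_zero

/-- The set of common zeros of a set of polynomials in the product of projective spaces. -/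
def zeroLocus {K : Type*} [Field K] {k : ℕ} {σ : Fin k → Type*}
    (S : Set (MvPolynomial (Σ i, σ i) K)) : Set (MultiProj K σ) :=
  {p | ∀ F ∈ S, VanishesAt F p}

/-- The Zariski topology: the closed sets are the common zero sets of arbitrary sets of
multihomogeneous forms. -/
instance zariskiTopology (K : Type*) [Field K] {k : ℕ} (σ : Fin k → Type*) :
    TopologicalSpace (MultiProj K σ) :=
  TopologicalSpace.ofClosed
    {Z | ∃ S : Set (MvPolynomial (Σ i, σ i) K), (∀ F ∈ S, IsMultihomogeneous F) ∧ Z = zeroLocus S}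
    (by
      refine ⟨{1}, ?_, ?_⟩
      · rintro F rfl
        exact ⟨0, MvPolynomial.isWeightedHomogeneous_one _ _⟩
      · ext p
        simp [zeroLocus, VanishesAt])
    (by
      intro A hA
      choose! S hS hS' using fun Z (hZ : Z ∈ A) => hA hZ
      refine ⟨⋃ Z ∈ A, S Z, ?_, ?_⟩
      · intro F hF
        simp only [Set.mem_iUnion] at hF
        obtain ⟨Z, hZ, hF⟩ := hF
        exact hS Z hZ F hF
      · ext p
        simp only [Set.mem_sInter, zeroLocus, Set.mem_iUnion, Set.mem_ofPred_eq]
        constructor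
        · rintro h F ⟨Z, hZ, hF⟩
          have := h Z hZ
          rw [hS' Z hZ] at this
          exact this F hF
        · intro h Z hZ
          rw [hS' Z hZ]
          exact fun F hF => h F ⟨Z, hZ, hF⟩)
    (by
      rintro _ ⟨S, hS, rfl⟩ _ ⟨T, hT, rfl⟩
      refine ⟨{H | ∃ F ∈ S, ∃ G ∈ T, H = F * G}, ?_, ?_⟩
      · rintro _ ⟨F, hF, G, hG, rfl⟩
        obtain ⟨D, hD⟩ := hS F hF
        obtain ⟨E, hE⟩ := hT G hG
        exact ⟨D + E, hD.mul hE⟩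
      · ext p
        simp only [zeroLocus, VanishesAt, Set.mem_union, Set.mem_ofPred_eq]
        constructor
        · rintro (h | h) _ ⟨F, hF, G, hG, rfl⟩
          · simp [h F hF]
          · simp [h G hG]
        · intro h
          by_contra! hc
          obtain ⟨⟨F, hF, hF0⟩, ⟨G, hG, hG0⟩⟩ := hc
          have := h _ ⟨F, hF, G, hG, rfl⟩
          rw [map_mul, mul_eq_zero] at this
          tauto)

/-! ### Grassmannians and their Plücker embeddings -/

/-- The Grassmannian of `d`-dimensional linear subspaces of `K^m`, that is, of
`(d - 1)`-dimensional projective linear subspaces of `ℙ^{m-1}`. -/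
def Gr (K : Type*) [Field K] (d m : ℕ) : Type _ :=
  {W : Submodule K (Fin m → K) // Module.finrank K W = d}

/-- The index set of the Plücker coordinates: increasing `d`-tuples of elements of `Fin m`. -/
abbrev PluckerIndex (d m : ℕ) : Type := Fin d ↪o Fin m

/-- The vector of maximal minors of a `d × m` matrix. -/
def minors {K : Type*} [Field K] {d m : ℕ} (A : Matrix (Fin d) (Fin m) K) :
    PluckerIndex d m → K :=
  fun I => (A.submatrix id I).det

/-- A matrix with linearly independent rows has a nonzero maximal minor. -/
theorem minors_ne_zero {K : Type*} [Field K] {d m : ℕ} {A : Matrix (Fin d) (Fin m) K}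
    (hA : LinearIndependent K A.row) : minors A ≠ 0 := by
  have hr : Module.finrank K (Submodule.span K (Set.range A.col)) = d := by
    rw [← Matrix.rank_eq_finrank_span_cols, hA.rank_matrix, Fintype.card_fin]
  obtain ⟨f, hf, -, hli⟩ : ∃ f : Fin d → Fin d → K, (∀ i, f i ∈ Set.range A.col) ∧
      Submodule.span K (Set.range f) = Submodule.span K (Set.range A.col) ∧
      LinearIndependent K f := by
    have h := Submodule.exists_fun_fin_finrank_span_eq K (Set.range A.col)
    rwa [hr] at h
  choose g hg using hf
  have hginj : Function.Injective g := fun a b hab => hli.injective (by rw [← hg, ← hg, hab])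
  have hmono : StrictMono (g ∘ Tuple.sort g) :=
    (Tuple.monotone_sort g).strictMono_of_injective (hginj.comp (Tuple.sort g).injective)
  intro h0
  have h1 : (A.submatrix id (g ∘ Tuple.sort g)).det = 0 :=
    congrFun h0 (OrderEmbedding.ofStrictMono _ hmono)
  have hcol : (A.submatrix id (g ∘ Tuple.sort g)).col = f ∘ Tuple.sort g := by
    funext j
    rw [Function.comp, ← hg]
    rfl
  have h2 : LinearIndependent K (A.submatrix id (g ∘ Tuple.sort g)).col := by
    rw [hcol]
    exact hli.comp _ (Tuple.sort g).injective
  rw [Matrix.linearIndependent_cols_iff_isUnit, Matrix.isUnit_iff_isUnit_det, h1] at h2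
  exact not_isUnit_zero h2

/-- The matrix whose rows are the vectors of a basis of `W`. -/
noncomputable def basisMatrix {K : Type*} [Field K] {d m : ℕ} {W : Submodule K (Fin m → K)}
    (b : Module.Basis (Fin d) K W) : Matrix (Fin d) (Fin m) K :=
  Matrix.of fun i => (b i : Fin m → K)

theorem minors_basisMatrix_ne_zero {K : Type*} [Field K] {d m : ℕ}
    {W : Submodule K (Fin m → K)} (b : Module.Basis (Fin d) K W) : minors (basisMatrix b) ≠ 0 :=
  minors_ne_zero (b.linearIndependent.map' W.subtype W.ker_subtype)

/-- The Plücker embedding: it sends `W` to the point whose homogeneous coordinates are the maximal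
minors of a matrix with row space `W`. The choice of the basis is irrelevant, see
`plucker_eq_mk`. -/
noncomputable def plucker {K : Type*} [Field K] {d m : ℕ} (W : Gr K d m) :
    ℙ K (PluckerIndex d m → K) :=
  Projectivization.mk K (minors (basisMatrix (Module.finBasisOfFinrankEq K W.1 W.2)))
    (minors_basisMatrix_ne_zero _)

theorem plucker_eq_mk {K : Type*} [Field K] {d m : ℕ} (W : Gr K d m)
    (b : Module.Basis (Fin d) K W.1) :
    plucker W = Projectivization.mk K (minors (basisMatrix b)) (minors_basisMatrix_ne_zero b) := by
  unfold plucker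
  rw [Projectivization.mk_eq_mk_iff']
  generalize Module.finBasisOfFinrankEq K W.1 W.2 = b'
  refine ⟨((b.toMatrix b').transpose).det, ?_⟩
  funext I
  have h : basisMatrix b' = (b.toMatrix b').transpose * basisMatrix b := by
    ext i j
    have h := congrArg (fun w : W.1 => (w : Fin m → K) j) (b.sum_toMatrix_smul_self b' i)
    rw [Matrix.mul_apply]
    refine Eq.trans h.symm ?_
    simp only [Submodule.coe_sum, Finset.sum_apply]
    rfl
  simp only [minors, Pi.smul_apply, smul_eq_mul]
  rw [h, ← Matrix.det_mul]
  rfl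

/-- The product of the Grassmannians `Gr K (d i) (m i)`, `i : Fin k`. -/
def GrProd (K : Type*) [Field K] {k : ℕ} (d m : Fin k → ℕ) : Type _ :=
  (i : Fin k) → Gr K (d i) (m i)

/-- The product of the Plücker embeddings. -/
noncomputable def multiPlucker {K : Type*} [Field K] {k : ℕ} {d m : Fin k → ℕ}
    (W : GrProd K d m) : MultiProj K (fun i => PluckerIndex (d i) (m i)) :=
  fun i => plucker (W i)

/-- The Zariski topology on a product of Grassmannians, as a subspace of the product of the
projective spaces of the Plücker embeddings. -/
noncomputable instance GrProd.zariskiTopology (K : Type*) [Field K] {k : ℕ} (d m : Fin k → ℕ) :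
    TopologicalSpace (GrProd K d m) :=
  TopologicalSpace.induced multiPlucker
    (MultiPlucker.zariskiTopology K (fun i => PluckerIndex (d i) (m i)))

/-- The zero set `Z(F)`, inside the product of Grassmannians, of a form `F` in the
(multi-)Plücker coordinates. -/
def zeroSet {K : Type*} [Field K] {k : ℕ} {d m : Fin k → ℕ}
    (F : MvPolynomial (Σ i, PluckerIndex (d i) (m i)) K) : Set (GrProd K d m) :=
  {W | VanishesAt F (multiPlucker W)}

/-! ### Hypersurfaces -/

/-- A hypersurface of `X`: a closed subset all of whose irreducible components, i.e. all maximal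
irreducible closed subsets, have codimension one in `X`. -/
def IsHypersurface {X : Type*} [TopologicalSpace X] (Z : Set X) : Prop :=
  IsClosed Z ∧
    ∀ C : TopologicalSpace.IrreducibleCloseds X,
      Maximal (fun C' : TopologicalSpace.IrreducibleCloseds X => (C' : Set X) ⊆ Z) C →
        Order.coheight C = 1

end MultiPlucker

/-!
A hypersurface of a product of Grassmannians is cut out by one form because the polynomial ring
`R` in the entries of `d i × m i` matrices, `i : Fin k`, is factorial: full-rank tuples of matrices
represent the points of the product, forms in the Plücker coordinates pull back to `R`
(`pullback`), and the group `∏ i, GL (d i)` acts on `R` by left multiplication.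

Let `F₀` be a form that vanishes on the hypersurface `Z` but not identically. As the group is
connected, it fixes every irreducible factor `f` of the pullback of `F₀` up to scalars
(`dvd_leftMul_of_dvd_pullback`). The scalar is a multiplicative polynomial function of the group
element, hence a product of powers of determinants (`exists_eq_prod_det_pow`): `f` is a
semi-invariant (`isSemiInvariant_of_dvd_leftMul`).

The first fundamental theorem would say that a semi-invariant `f` is itself a form in the minors.
It suffices that some power of `f` is one (`IsSemiInvariant.exists_pullback_eq_pow`), which has a
short proof in every characteristic. Evaluating `f` at `adj(A_I) * A`, whose entries are minors of
`A` up to sign by Cramer's rule, shows that the product of `f` and large powers of the minors `p_I`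
is a form in the minors, for each chart `I`. By the pigeonhole principle, `f` maps all forms in the
minors of large multidegree to such forms, and as the ring of forms is Noetherian, `f` satisfies
equations `f ^ r = ∑ b i * f ^ i` with a bounded number of terms, in which the `b i` are forms of
multidegree so large, for large `r`, that each `b i * f ^ i` is again a form in the minors.

So the zero set of `f` in the product of Grassmannians is the zero set of a form, and by the
Nullstellensatz it is irreducible (`isIrreducible_zeroSet_of_prime`). An irreducible component of
`Z` lies in one of these proper irreducible closed sets, and equals it, having codimension one. The
product of the forms that belong to the components of `Z` defines `Z`.
-/

namespace MultiPlucker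

/-! ### Multihomogeneous polynomials and scaling -/

/-- Rescaling the variables multiplies the coefficient of each monomial by the monomial evaluated
at the scaling factors. -/
theorem coeff_aeval_C_mul_X {K : Type*} [Field K] {τ : Type*} (c : τ → K)
    (F : MvPolynomial τ K) (e : τ →₀ ℕ) :
    (MvPolynomial.aeval (fun s => MvPolynomial.C (c s) * MvPolynomial.X s) F).coeff e =
      (e.prod fun s a => c s ^ a) * F.coeff e := by
  classical
  induction F using MvPolynomial.induction_on' with
  | monomial u a =>
    have h : MvPolynomial.aeval (fun s => MvPolynomial.C (c s) * MvPolynomial.X s)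
        (MvPolynomial.monomial u a) =
        MvPolynomial.C (u.prod fun s a => c s ^ a) * MvPolynomial.monomial u a := by
      rw [MvPolynomial.aeval_monomial, MvPolynomial.monomial_eq]
      simp only [mul_pow, Finsupp.prod_mul, MvPolynomial.algebraMap_eq]
      rw [Finsupp.prod, Finsupp.prod, Finsupp.prod, map_prod]
      simp only [map_pow]
      ring
    rw [h, MvPolynomial.coeff_C_mul, MvPolynomial.coeff_monomial]
    split_ifs with hu
    · rw [hu]
    · simp
  | add p q hp hq => simp only [map_add, MvPolynomial.coeff_add, hp, hq, mul_add]

theorem prod_pow_eq_prod_pow_weight {K : Type*} [CommRing K] {k : ℕ} {σ : Fin k → Type*}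
    (t : Fin k → K) (e : (Σ i, σ i) →₀ ℕ) :
    (e.prod fun s a => t s.1 ^ a) = ∏ i, t i ^
      (Finsupp.weight (fun s : Σ i, σ i => (Pi.single s.1 1 : Fin k → ℕ)) e) i := by
  rw [Finsupp.weight_apply, Finsupp.sum, Finsupp.prod]
  simp only [Finset.sum_apply, Pi.smul_apply, smul_eq_mul]
  simp_rw [← Finset.prod_pow_eq_pow_sum]
  rw [Finset.prod_comm]
  refine Finset.prod_congr rfl fun s _ => ?_
  rw [Finset.prod_eq_single s.1]
  · simp
  · intro j _ hj
    simp [hj]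
  · simp

theorem eq_of_forall_prod_pow_eq {K : Type*} [Field K] [Infinite K] {k : ℕ} {n D : Fin k → ℕ}
    (h : ∀ t : Fin k → K, ∏ i, t i ^ n i = ∏ i, t i ^ D i) : n = D := by
  have : (MvPolynomial.monomial (Finsupp.equivFunOnFinite.symm n) (1 : K)) =
      MvPolynomial.monomial (Finsupp.equivFunOnFinite.symm D) 1 := by
    refine MvPolynomial.funext fun t => ?_
    simpa [MvPolynomial.eval_monomial, Finsupp.prod_fintype] using h t
  simpa using MvPolynomial.monomial_left_injective (one_ne_zero) this

/-- Over an infinite field, a polynomial that is homogeneous as a function is homogeneous. -/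
theorem isMultihomogeneousOfDegree_of_eval {K : Type*} [Field K] [Infinite K] {k : ℕ}
    {σ : Fin k → Type*} {F : MvPolynomial (Σ i, σ i) K} {D : Fin k → ℕ}
    (h : ∀ (t : Fin k → K) (x : (Σ i, σ i) → K),
      MvPolynomial.eval (fun s => t s.1 * x s) F = (∏ i, t i ^ D i) * MvPolynomial.eval x F) :
    IsMultihomogeneousOfDegree F D := by
  intro e he
  refine eq_of_forall_prod_pow_eq (K := K) fun t => ?_
  have h1 : MvPolynomial.aeval (fun s : Σ i, σ i => MvPolynomial.C (t s.1) * MvPolynomial.X s) F =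
      MvPolynomial.C (∏ i, t i ^ D i) * F := by
    refine MvPolynomial.funext fun x => ?_
    rw [map_mul, MvPolynomial.eval_C, ← h, ← MvPolynomial.aeval_eq_eval,
      ← MvPolynomial.aeval_eq_eval]
    change ((MvPolynomial.aeval x).comp (MvPolynomial.aeval _)) F = _
    rw [MvPolynomial.comp_aeval]
    simp
  have h2 := congrArg (MvPolynomial.coeff e) h1
  rw [coeff_aeval_C_mul_X (fun s : Σ i, σ i => t s.1), MvPolynomial.coeff_C_mul,
    prod_pow_eq_prod_pow_weight] at h2
  exact mul_right_cancel₀ he h2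

/-- The homogeneity relation, for values in an arbitrary commutative algebra. -/
theorem aeval_smul {K : Type*} [Field K] {k : ℕ} {σ : Fin k → Type*} {S : Type*} [CommRing S]
    [Algebra K S] {F : MvPolynomial (Σ i, σ i) K} {D : Fin k → ℕ}
    (hF : IsMultihomogeneousOfDegree F D) (c : Fin k → S) (x : (Σ i, σ i) → S) :
    MvPolynomial.aeval (fun s => c s.1 * x s) F = (∏ i, c i ^ D i) * MvPolynomial.aeval x F := by
  rw [MvPolynomial.aeval_def, MvPolynomial.aeval_def, MvPolynomial.eval₂_eq,
    MvPolynomial.eval₂_eq, Finset.mul_sum]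
  refine Finset.sum_congr rfl fun e he => ?_
  have h := hF (MvPolynomial.mem_support_iff.mp he)
  have h2 : ∏ s ∈ e.support, c s.1 ^ e s = ∏ i, c i ^ D i := by
    rw [← h, ← prod_pow_eq_prod_pow_weight, Finsupp.prod]
  simp_rw [mul_pow, Finset.prod_mul_distrib, h2]
  ring

/-! ### Polynomials in the entries of matrices, and the minors -/

/-- The entries of a tuple of matrices, the `i`-th one of size `d i × m i`. -/
abbrev MatVar {k : ℕ} (d m : Fin k → ℕ) : Type := Σ i, Fin (d i) × Fin (m i)

/-- The Plücker coordinates of all the factors. -/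
abbrev PlVar {k : ℕ} (d m : Fin k → ℕ) : Type := Σ i, PluckerIndex (d i) (m i)

/-- Tuples of matrices with entries in `S`, the `i`-th one of size `d i × m i`. -/
abbrev MatTuple (S : Type*) {k : ℕ} (d m : Fin k → ℕ) : Type _ :=
  (i : Fin k) → Matrix (Fin (d i)) (Fin (m i)) S

section
variable {K : Type*} [Field K] {k : ℕ} {d m : Fin k → ℕ}

/-- The value of a polynomial in the entries of matrices at a tuple of matrices. -/
noncomputable def evalMat {S : Type*} [CommRing S] [Algebra K S] (A : MatTuple S d m) :
    MvPolynomial (MatVar d m) K →ₐ[K] S :=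
  MvPolynomial.aeval fun s => A s.1 s.2.1 s.2.2

/-- The vector of all maximal minors of a tuple of matrices. -/
def minorsOf {S : Type*} [CommRing S] (A : MatTuple S d m) (s : PlVar d m) : S :=
  ((A s.1).submatrix id s.2).det

variable (K d m) in
/-- The tuple of generic matrices, whose entries are the variables. -/
noncomputable def genericMat : MatTuple (MvPolynomial (MatVar d m) K) d m :=
  fun i => Matrix.of fun a j => MvPolynomial.X ⟨i, a, j⟩

variable (K d m) in
/-- Substitution of the minors of the generic matrices for the Plücker coordinates. -/
noncomputable def pullback : MvPolynomial (PlVar d m) K →ₐ[K] MvPolynomial (MatVar d m) K :=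
  MvPolynomial.aeval (minorsOf (genericMat K d m))

theorem map_minorsOf {S T : Type*} [CommRing S] [Algebra K S] [CommRing T] [Algebra K T]
    (φ : S →ₐ[K] T) (A : MatTuple S d m) (s : PlVar d m) :
    φ (minorsOf A s) = minorsOf (fun i => (A i).map φ) s := by
  unfold minorsOf
  rw [AlgHom.map_det]
  rfl

theorem map_evalMat {S T : Type*} [CommRing S] [Algebra K S] [CommRing T] [Algebra K T]
    (φ : S →ₐ[K] T) (A : MatTuple S d m) (f : MvPolynomial (MatVar d m) K) :
    φ (evalMat A f) = evalMat (fun i => (A i).map φ) f := by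
  unfold evalMat
  rw [← AlgHom.comp_apply, MvPolynomial.comp_aeval]
  rfl

theorem evalMat_genericMat {S : Type*} [CommRing S] [Algebra K S] (A : MatTuple S d m) :
    (fun i => (genericMat K d m i).map (evalMat A)) = A := by
  funext i
  ext a j
  simp [genericMat, evalMat]

theorem evalMat_pullback {S : Type*} [CommRing S] [Algebra K S] (A : MatTuple S d m)
    (F : MvPolynomial (PlVar d m) K) :
    evalMat A (pullback K d m F) = MvPolynomial.aeval (minorsOf A) F := by
  unfold pullback
  rw [← AlgHom.comp_apply, MvPolynomial.comp_aeval]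
  congr 2
  funext s
  rw [map_minorsOf, evalMat_genericMat]

theorem minorsOf_mul {S : Type*} [CommRing S] (g : (i : Fin k) → Matrix (Fin (d i)) (Fin (d i)) S)
    (A : MatTuple S d m) :
    minorsOf (fun i => g i * A i) = fun s => (g s.1).det * minorsOf A s := by
  funext s
  unfold minorsOf
  rw [← Matrix.det_mul]
  rfl

theorem evalMat_funext [Infinite K] {f g : MvPolynomial (MatVar d m) K}
    (h : ∀ A : MatTuple K d m, evalMat A f = evalMat A g) : f = g := by
  refine MvPolynomial.funext fun x => ?_
  simpa [evalMat, MvPolynomial.aeval_eq_eval] using h fun i => Matrix.of fun a j => x ⟨i, a, j⟩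

/-- The matrices with the identity matrix in the columns `I i` and zeros elsewhere. -/
theorem exists_minorsOf_eq_one (I : (i : Fin k) → PluckerIndex (d i) (m i)) :
    ∃ A : MatTuple K d m, ∀ i, minorsOf A ⟨i, I i⟩ = 1 := by
  refine ⟨fun i => Matrix.of fun a j => if j = I i a then 1 else 0, fun i => ?_⟩
  unfold minorsOf
  rw [← Matrix.det_one (n := Fin (d i)) (R := K)]
  congr 1
  ext a b
  simp [Matrix.one_apply, eq_comm]

theorem pullback_X_ne_zero (s : PlVar d m) (hs : ∀ i, Nonempty (PluckerIndex (d i) (m i))) :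
    pullback K d m (MvPolynomial.X s) ≠ 0 := by
  classical
  intro h
  obtain ⟨A, hA⟩ := exists_minorsOf_eq_one (K := K)
    (Function.update (fun i => (hs i).some) s.1 s.2)
  have h1 := evalMat_pullback A (MvPolynomial.X (R := K) s)
  have h2 := hA s.1
  rw [Function.update_self] at h2
  rw [h, map_zero, MvPolynomial.aeval_X] at h1
  change minorsOf A s = 1 at h2
  exact zero_ne_one (h1.trans h2)

/-! ### Charts -/

/-- A maximal minor with arbitrary column indices is a multiple of a Plücker coordinate. -/
theorem exists_det_submatrix_eq {n N : ℕ} (J : PluckerIndex n N) (h : Fin n → Fin N) :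
    ∃ (c : K) (J : PluckerIndex n N), ∀ A : Matrix (Fin n) (Fin N) K,
      (A.submatrix id h).det = c * (A.submatrix id J).det := by
  by_cases hinj : Function.Injective h
  · have hmono : StrictMono (h ∘ Tuple.sort h) :=
      (Tuple.monotone_sort h).strictMono_of_injective (hinj.comp (Tuple.sort h).injective)
    refine ⟨((Equiv.Perm.sign (Tuple.sort h) : ℤ) : K), OrderEmbedding.ofStrictMono _ hmono,
      fun A => ?_⟩
    have h1 := Matrix.det_permute' (Tuple.sort h) (A.submatrix id h)
    change (A.submatrix id (h ∘ Tuple.sort h)).det = _ at h1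
    change _ = _ * (A.submatrix id (h ∘ Tuple.sort h)).det
    rw [h1, ← mul_assoc, ← Int.cast_mul, ← Units.val_mul, Int.units_mul_self]
    simp
  · refine ⟨0, J, fun A => ?_⟩
    obtain ⟨a, b, hab, hne⟩ : ∃ a b, h a = h b ∧ a ≠ b := by
      simpa [Function.Injective] using hinj
    rw [zero_mul]
    exact Matrix.det_zero_of_column_eq hne fun i => by simp [hab]

/-- Cramer's rule: column `j` of `A` replaces the column of `A_I` with number `a`. -/
theorem adjugate_submatrix_mul_apply {n N : ℕ} (I : Fin n → Fin N) (A : Matrix (Fin n) (Fin N) K)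
    (a : Fin n) (j : Fin N) :
    ((A.submatrix id I).adjugate * A) a j = (A.submatrix id (Function.update I a j)).det := by
  have h := congrFun (Matrix.cramer_eq_adjugate_mulVec (A.submatrix id I) (fun b => A b j)) a
  rw [Matrix.cramer_apply] at h
  rw [Matrix.mul_apply]
  refine Eq.trans h.symm ?_
  congr 1
  ext b c
  by_cases hc : c = a
  · subst hc; simp
  · simp [hc]

/-- The entries of `adj(A_I) * A`, where `A_I` is the square submatrix of `A` with
columns `I`, are linear forms in the maximal minors of `A`. -/
theorem exists_linearForms_adjugate_mul (I : (i : Fin k) → PluckerIndex (d i) (m i)) :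
    ∃ L : MatTuple (MvPolynomial (PlVar d m) K) d m,
      (∀ (t : Fin k → K) (x : PlVar d m → K) i a j,
        MvPolynomial.eval (fun s => t s.1 * x s) (L i a j) =
          t i * MvPolynomial.eval x (L i a j)) ∧
      ∀ (A : MatTuple K d m) i a j, MvPolynomial.eval (minorsOf A) (L i a j) =
        (((A i).submatrix id (I i)).adjugate * A i) a j := by
  -- The entry at `a, j` is the minor whose column indices are `I i`, with `j` at position `a`.
  choose c J h using fun i (g : Fin (d i) → Fin (m i)) =>
    exists_det_submatrix_eq (K := K) (I i) g
  refine ⟨fun i => Matrix.of fun a j =>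
    MvPolynomial.C (c i (Function.update (I i) a j)) *
      MvPolynomial.X ⟨i, J i (Function.update (I i) a j)⟩, ?_, ?_⟩
  · intro t x i a j
    simp
    ring
  · intro A i a j
    rw [adjugate_submatrix_mul_apply, h]
    simp [minorsOf]

end

/-! ### Semi-invariants -/

section
variable {K : Type*} [Field K] {k : ℕ} {d m : Fin k → ℕ}

/-- `f` is a semi-invariant of weight `D`: left multiplication of the `i`-th matrix by `g i`
multiplies the value of `f` by `det (g i) ^ D i`. As a `0 × 0` determinant is `1`, the weight would
not be determined at the indices `i` with `d i = 0`; it is required to be zero there. -/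
structure IsSemiInvariant (f : MvPolynomial (MatVar d m) K) (D : Fin k → ℕ) : Prop where
  weight_eq_zero : ∀ i, d i = 0 → D i = 0
  evalMat_mul : ∀ (g : (i : Fin k) → Matrix (Fin (d i)) (Fin (d i)) K) (A : MatTuple K d m),
    evalMat (fun i => g i * A i) f = (∏ i, (g i).det ^ D i) * evalMat A f

/-- Restricting a semi-invariant `f` to a chart: up to powers of the Plücker coordinates of the
chart, `f` is a form in the minors, obtained by evaluating `f` on `adj(A_I) * A`. -/
theorem IsSemiInvariant.exists_pullback_eq [Infinite K] {f : MvPolynomial (MatVar d m) K}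
    {D : Fin k → ℕ} (hf : IsSemiInvariant f D) (I : (i : Fin k) → PluckerIndex (d i) (m i)) :
    ∃ F : MvPolynomial (PlVar d m) K, IsMultihomogeneousOfDegree F (fun i => d i * D i) ∧
      pullback K d m F =
        pullback K d m (∏ i, MvPolynomial.X ⟨i, I i⟩ ^ ((d i - 1) * D i)) * f := by
  obtain ⟨L, hL, hL'⟩ := exists_linearForms_adjugate_mul (K := K) I
  have key : ∀ x : PlVar d m → K, MvPolynomial.eval x (evalMat L f) =
      evalMat (fun i => (L i).map (MvPolynomial.eval x)) f := fun x =>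
    map_evalMat (MvPolynomial.aeval x) L f
  refine ⟨evalMat L f, isMultihomogeneousOfDegree_of_eval fun t x => ?_, evalMat_funext fun A => ?_⟩
  · rw [key, key]
    have h : (fun i => (L i).map (MvPolynomial.eval fun s : PlVar d m => t s.1 * x s)) =
        fun i => (t i • (1 : Matrix (Fin (d i)) (Fin (d i)) K)) *
          (L i).map (MvPolynomial.eval x) := by
      funext i
      ext a j
      simp [hL]
    rw [h, hf.evalMat_mul]
    simp [pow_mul]
  · rw [evalMat_pullback, MvPolynomial.aeval_eq_eval, key]
    have h : (fun i => (L i).map (MvPolynomial.eval (minorsOf A))) =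
        fun i => ((A i).submatrix id (I i)).adjugate * A i := by
      funext i
      ext a j
      simp [hL']
    rw [h, hf.evalMat_mul, map_mul, evalMat_pullback]
    simp only [Matrix.det_adjugate, Fintype.card_fin, map_prod, map_pow, MvPolynomial.aeval_X,
      minorsOf, pow_mul]

/-- Pigeonhole: a monomial of large multidegree is divisible by large powers of one Plücker
coordinate in each group. -/
theorem exists_monomial_eq_mul {n c : Fin k → ℕ} (e : PlVar d m →₀ ℕ)
    (hne : ∀ i, Nonempty (PluckerIndex (d i) (m i)))
    (he : Finsupp.weight (fun s : PlVar d m => (Pi.single s.1 1 : Fin k → ℕ)) e = n)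
    (hn : ∀ i, c i * Fintype.card (PluckerIndex (d i) (m i)) ≤ n i) :
    ∃ (I : (i : Fin k) → PluckerIndex (d i) (m i)) (e' : PlVar d m →₀ ℕ), ∀ a : K,
      MvPolynomial.monomial e a =
        (∏ i, MvPolynomial.X (⟨i, I i⟩ : PlVar d m) ^ c i) * MvPolynomial.monomial e' a := by
  classical
  have hI : ∀ i, ∃ J : PluckerIndex (d i) (m i), c i ≤ e ⟨i, J⟩ := by
    intro i
    by_contra! h
    have hw : n i = ∑ J : PluckerIndex (d i) (m i), e ⟨i, J⟩ := by
      rw [← he, Finsupp.weight_apply, Finsupp.sum_fintype _ _ (by simp), Finset.sum_apply,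
        Fintype.sum_sigma, Finset.sum_eq_single i]
      · simp
      · intro j _ hj
        simp [hj.symm]
      · simp
    have := Finset.sum_lt_sum_of_nonempty (s := Finset.univ) Finset.univ_nonempty
      fun J (_ : J ∈ Finset.univ) => h J
    rw [← hw, Finset.sum_const, Finset.card_univ, smul_eq_mul, mul_comm] at this
    exact absurd (hn i) (not_le.mpr this)
  choose I hI using hI
  have hle : (∑ i, Finsupp.single (⟨i, I i⟩ : PlVar d m) (c i)) ≤ e := by
    intro s
    rw [Finsupp.finsetSum_apply]
    by_cases hs : s.2 = I s.1
    · rw [Finset.sum_eq_single s.1]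
      · have : (⟨s.1, I s.1⟩ : PlVar d m) = s := by rw [← hs]
        rw [this, Finsupp.single_eq_same, ← this]
        exact hI _
      · intro j _ hj
        rw [Finsupp.single_eq_of_ne]
        exact fun h => hj (congrArg Sigma.fst h).symm
      · simp
    · rw [Finset.sum_eq_zero]
      · exact Nat.zero_le _
      · intro j _
        rw [Finsupp.single_eq_of_ne]
        rintro rfl
        exact hs rfl
  obtain ⟨e', he'⟩ := le_iff_exists_add.mp hle
  refine ⟨I, e', fun a => ?_⟩
  have : ∀ i, MvPolynomial.X (R := K) (⟨i, I i⟩ : PlVar d m) ^ c i =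
      MvPolynomial.monomial (Finsupp.single (⟨i, I i⟩ : PlVar d m) (c i)) 1 := fun i =>
    MvPolynomial.X_pow_eq_monomial
  simp_rw [this, ← MvPolynomial.monomial_sum_one, MvPolynomial.monomial_mul, one_mul, ← he']

theorem isMultihomogeneousOfDegree_X (s : PlVar d m) :
    IsMultihomogeneousOfDegree (MvPolynomial.X (R := K) s) (Pi.single s.1 1) :=
  MvPolynomial.isWeightedHomogeneous_X _ _ _

theorem isMultihomogeneousOfDegree_prod_X_pow (I : (i : Fin k) → PluckerIndex (d i) (m i))
    (c : Fin k → ℕ) :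
    IsMultihomogeneousOfDegree (∏ i, MvPolynomial.X (R := K) (⟨i, I i⟩ : PlVar d m) ^ c i) c := by
  have h := MvPolynomial.IsWeightedHomogeneous.prod
    (w := fun s : PlVar d m => (Pi.single s.1 1 : Fin k → ℕ)) Finset.univ
    (fun i => MvPolynomial.X (R := K) (⟨i, I i⟩ : PlVar d m) ^ c i)
    (fun i => c i • Pi.single i 1)
    fun i _ => (isMultihomogeneousOfDegree_X (⟨i, I i⟩ : PlVar d m)).pow (c i)
  have hc : c = ∑ i, c i • (Pi.single i 1 : Fin k → ℕ) := by
    funext j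
    simp [Finset.sum_apply, Pi.single_apply]
  unfold IsMultihomogeneousOfDegree
  rwa [← hc] at h

/-- Multiplication by a semi-invariant of weight `D` maps forms in the minors of large
multidegree `n` to forms in the minors of multidegree `n + D`. -/
theorem IsSemiInvariant.exists_mul_pullback_eq [Infinite K] {f : MvPolynomial (MatVar d m) K}
    {D : Fin k → ℕ} (hf : IsSemiInvariant f D)
    (hne : ∀ i, Nonempty (PluckerIndex (d i) (m i))) {n : Fin k → ℕ}
    (hn : ∀ i, (d i - 1) * D i * Fintype.card (PluckerIndex (d i) (m i)) ≤ n i)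
    {F : MvPolynomial (PlVar d m) K} (hF : IsMultihomogeneousOfDegree F n) :
    ∃ F' : MvPolynomial (PlVar d m) K, IsMultihomogeneousOfDegree F' (n + D) ∧
      pullback K d m F' = pullback K d m F * f := by
  classical
  suffices h : ∀ e ∈ F.support, ∃ F' : MvPolynomial (PlVar d m) K,
      IsMultihomogeneousOfDegree F' (n + D) ∧
        pullback K d m F' = pullback K d m (MvPolynomial.monomial e (F.coeff e)) * f by
    choose! G hG hG' using h
    refine ⟨∑ e ∈ F.support, G e, MvPolynomial.IsWeightedHomogeneous.sum _ _ _ hG, ?_⟩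
    rw [map_sum, Finset.sum_congr rfl hG', ← Finset.sum_mul, ← map_sum, ← F.as_sum]
  intro e he
  have hen := hF (MvPolynomial.mem_support_iff.mp he)
  obtain ⟨I, e', hI⟩ := exists_monomial_eq_mul (K := K) (c := fun i => (d i - 1) * D i) e hne hen hn
  obtain ⟨G, hG, hG'⟩ := hf.exists_pullback_eq I
  have he' : (fun i => (d i - 1) * D i) +
      Finsupp.weight (fun s : PlVar d m => (Pi.single s.1 1 : Fin k → ℕ)) e' = n := by
    have h1 : IsMultihomogeneousOfDegree (MvPolynomial.monomial e (1 : K)) n :=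
      MvPolynomial.isWeightedHomogeneous_monomial _ _ _ hen
    have h2 := (isMultihomogeneousOfDegree_prod_X_pow (K := K) I fun i => (d i - 1) * D i).mul
      (MvPolynomial.isWeightedHomogeneous_monomial
        (fun s : PlVar d m => (Pi.single s.1 1 : Fin k → ℕ)) e' (1 : K) rfl)
    rw [← hI] at h2
    exact MvPolynomial.IsWeightedHomogeneous.inj_right
      (by simp [MvPolynomial.monomial_eq_zero]) h2 h1
  refine ⟨G * MvPolynomial.monomial e' (F.coeff e), ?_, ?_⟩
  · have h := hG.mul (MvPolynomial.isWeightedHomogeneous_monomial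
        (fun s : PlVar d m => (Pi.single s.1 1 : Fin k → ℕ)) e' (F.coeff e) rfl)
    refine Eq.subst (motive := IsMultihomogeneousOfDegree _) ?_ h
    rw [← he']
    funext i
    simp only [Pi.add_apply]
    rcases Nat.eq_zero_or_pos (d i) with h0 | h0
    · simp [hf.weight_eq_zero i h0]
    · obtain ⟨b, hb⟩ := Nat.exists_eq_add_of_lt h0
      rw [hb]
      simp
      ring
  · rw [map_mul, hG', hI, map_mul]
    ring

end

/-! ### A power of a semi-invariant is a form in the minors -/

theorem weightedHomogeneousComponent_add_mul {R M τ : Type*} [CommRing R] [AddCancelCommMonoid M]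
    {w : τ → M} {n e : M} (a : MvPolynomial τ R) {G : MvPolynomial τ R}
    (hG : G.IsWeightedHomogeneous w e) :
    MvPolynomial.weightedHomogeneousComponent w (n + e) (a * G) =
      MvPolynomial.weightedHomogeneousComponent w n a * G := by
  classical
  let := MvPolynomial.weightedGradedAlgebra R w
  have h := DirectSum.coe_decompose_mul_add_of_right_mem
    (MvPolynomial.weightedHomogeneousSubmodule R w) (i := n) (j := e) (a := a) (b := G) hG
  have key : ∀ (p : MvPolynomial τ R) (l : M),
      ((DirectSum.decompose (MvPolynomial.weightedHomogeneousSubmodule R w) p l :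
        MvPolynomial.weightedHomogeneousSubmodule R w l) : MvPolynomial τ R) =
        MvPolynomial.weightedHomogeneousComponent w l p := fun p l =>
    MvPolynomial.weightedDecomposition.decompose'_apply R w p l
  rwa [key, key] at h

section
variable {K : Type*} [Field K] {k : ℕ} {d m : Fin k → ℕ}

/-- Iterating the multiplication: the multidegree stays large when `D` is added to it. -/
theorem IsSemiInvariant.exists_mul_pow_pullback_eq [Infinite K] {f : MvPolynomial (MatVar d m) K}
    {D : Fin k → ℕ} (hf : IsSemiInvariant f D)
    (hne : ∀ i, Nonempty (PluckerIndex (d i) (m i))) {n : Fin k → ℕ}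
    (hn : ∀ i, (d i - 1) * D i * Fintype.card (PluckerIndex (d i) (m i)) ≤ n i)
    {F : MvPolynomial (PlVar d m) K} (hF : IsMultihomogeneousOfDegree F n) (j : ℕ) :
    ∃ F' : MvPolynomial (PlVar d m) K, IsMultihomogeneousOfDegree F' (n + j • D) ∧
      pullback K d m F' = pullback K d m F * f ^ j := by
  induction j with
  | zero => exact ⟨F, by simpa using hF, by simp⟩
  | succ j ih =>
    obtain ⟨G, hG, hG'⟩ := ih
    obtain ⟨G', h1, h2⟩ := hf.exists_mul_pullback_eq hne (n := n + j • D)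
      (fun i => (hn i).trans (by simp)) hG
    refine ⟨G', ?_, ?_⟩
    · rwa [succ_nsmul, ← add_assoc]
    · rw [h2, hG', pow_succ, mul_assoc]

/-- The forms in the minors of the multidegrees `n₀ + j • D`, where `n₀` is large, which are the
products of a fixed `g` with the powers `f ^ j`, generate a finitely generated ideal. This gives an
equation `f ^ r = ∑ i < r₀, b i * f ^ i`, for every `r ≥ r₀`, with forms `b i` in the minors of
multidegree `(r - i) • D`. -/
theorem IsSemiInvariant.exists_pow_eq_sum [Infinite K] {f : MvPolynomial (MatVar d m) K}
    {D : Fin k → ℕ} (hf : IsSemiInvariant f D)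
    (hne : ∀ i, Nonempty (PluckerIndex (d i) (m i))) :
    ∃ r₀ : ℕ, ∀ r ≥ r₀, ∃ b : Fin r₀ → MvPolynomial (PlVar d m) K,
      (∀ i, IsMultihomogeneousOfDegree (b i) ((r - i.1) • D)) ∧
        f ^ r = ∑ i, pullback K d m (b i) * f ^ i.1 := by
  set n₀ : Fin k → ℕ := fun i => (d i - 1) * D i * Fintype.card (PluckerIndex (d i) (m i)) with hn₀
  set G₀ : MvPolynomial (PlVar d m) K := ∏ i, MvPolynomial.X ⟨i, (hne i).some⟩ ^ n₀ i with hG₀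
  have hg : pullback K d m G₀ ≠ 0 := by
    rw [hG₀, map_prod]
    refine Finset.prod_ne_zero_iff.mpr fun i _ => ?_
    rw [map_pow]
    exact pow_ne_zero _ (pullback_X_ne_zero _ hne)
  have hex := hf.exists_mul_pow_pullback_eq hne (n := n₀) (fun _ => le_rfl)
    (isMultihomogeneousOfDegree_prod_X_pow (K := K) (fun i => (hne i).some) n₀)
  choose G hG hG' using hex
  obtain ⟨r₀, hr₀⟩ := monotone_stabilizes_iff_noetherian.mpr
    (inferInstance : IsNoetherian (MvPolynomial (PlVar d m) K) (MvPolynomial (PlVar d m) K))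
    ⟨fun j => Ideal.span (G '' Set.Iio j), fun i j hij =>
      Ideal.span_mono (Set.image_mono (Set.Iio_subset_Iio hij))⟩
  refine ⟨r₀, fun r hr => ?_⟩
  have hmem : G r ∈ Ideal.span (Set.range fun i : Fin r₀ => G i.1) := by
    have h1 : G r ∈ Ideal.span (G '' Set.Iio (r + 1)) :=
      Ideal.subset_span ⟨r, Nat.lt_succ_self r, rfl⟩
    have h2 := (hr₀ r hr).symm.trans (hr₀ (r + 1) (by omega))
    change Ideal.span (G '' Set.Iio r) = Ideal.span (G '' Set.Iio (r + 1)) at h2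
    have h3 := hr₀ r hr
    change Ideal.span (G '' Set.Iio r₀) = Ideal.span (G '' Set.Iio r) at h3
    rw [← h2, ← h3] at h1
    convert h1 using 2
    ext x
    constructor
    · rintro ⟨i, rfl⟩
      exact ⟨i.1, i.2, rfl⟩
    · rintro ⟨i, hi, rfl⟩
      exact ⟨⟨i, hi⟩, rfl⟩
  obtain ⟨a, ha⟩ := Ideal.mem_span_range_iff_exists_fun.mp hmem
  refine ⟨fun i => MvPolynomial.weightedHomogeneousComponent
    (fun s : PlVar d m => (Pi.single s.1 1 : Fin k → ℕ)) ((r - i.1) • D) (a i), fun i =>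
    MvPolynomial.weightedHomogeneousComponent_isWeightedHomogeneous _ _, ?_⟩
  have h1 := congrArg (MvPolynomial.weightedHomogeneousComponent
    (fun s : PlVar d m => (Pi.single s.1 1 : Fin k → ℕ)) (n₀ + r • D)) ha
  rw [map_sum, (hG r).weightedHomogeneousComponent_same] at h1
  have h2 : ∀ i : Fin r₀, MvPolynomial.weightedHomogeneousComponent
      (fun s : PlVar d m => (Pi.single s.1 1 : Fin k → ℕ)) (n₀ + r • D) (a i * G i.1) =
      MvPolynomial.weightedHomogeneousComponent
        (fun s : PlVar d m => (Pi.single s.1 1 : Fin k → ℕ)) ((r - i.1) • D) (a i) * G i.1 := by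
    intro i
    have h3 : n₀ + r • D = (r - i.1) • D + (n₀ + i.1 • D) := by
      rw [add_left_comm, ← add_nsmul, Nat.sub_add_cancel (i.2.le.trans hr)]
    rw [h3]
    exact weightedHomogeneousComponent_add_mul _ (hG i.1)
  rw [Finset.sum_congr rfl fun i _ => h2 i] at h1
  have h4 := congrArg (pullback K d m) h1
  simp only [map_sum, map_mul, hG'] at h4
  refine mul_left_cancel₀ hg ?_
  rw [← h4, Finset.mul_sum]
  exact Finset.sum_congr rfl fun i _ => by ring

/-- Some power of a semi-invariant is a form in the minors. -/
theorem IsSemiInvariant.exists_pullback_eq_pow [Infinite K] {f : MvPolynomial (MatVar d m) K}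
    {D : Fin k → ℕ} (hf : IsSemiInvariant f D)
    (hne : ∀ i, Nonempty (PluckerIndex (d i) (m i))) :
    ∃ (r : ℕ) (F : MvPolynomial (PlVar d m) K), r ≠ 0 ∧ IsMultihomogeneous F ∧
      pullback K d m F = f ^ r := by
  obtain ⟨r₀, h⟩ := hf.exists_pow_eq_sum hne
  set N : ℕ := 1 + ∑ i, d i * Fintype.card (PluckerIndex (d i) (m i)) with hN
  obtain ⟨b, hb, hsum⟩ := h (r₀ + N) (by omega)
  -- `N` is so large that the multidegree of every `b i` lets `b i` absorb the factor `f ^ i`.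
  have hlarge : ∀ (i : Fin r₀) (l : Fin k),
      (d l - 1) * D l * Fintype.card (PluckerIndex (d l) (m l)) ≤ ((r₀ + N - i.1) • D) l := by
    intro i l
    have h1 : d l * Fintype.card (PluckerIndex (d l) (m l)) ≤ N :=
      (Finset.single_le_sum (f := fun l => d l * Fintype.card (PluckerIndex (d l) (m l)))
        (fun _ _ => Nat.zero_le _) (Finset.mem_univ l)).trans (by omega)
    have h2 : N ≤ r₀ + N - i.1 := by omega
    calc (d l - 1) * D l * Fintype.card (PluckerIndex (d l) (m l))
        ≤ d l * D l * Fintype.card (PluckerIndex (d l) (m l)) := by gcongr; omega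
      _ = d l * Fintype.card (PluckerIndex (d l) (m l)) * D l := by ring
      _ ≤ (r₀ + N - i.1) * D l := by gcongr; omega
  choose G hG hG' using fun i : Fin r₀ =>
    hf.exists_mul_pow_pullback_eq hne (hlarge i) (hb i) i.1
  refine ⟨r₀ + N, ∑ i, G i, by omega, ⟨(r₀ + N) • D, ?_⟩, ?_⟩
  · refine MvPolynomial.IsWeightedHomogeneous.sum _ _ _ fun i _ => ?_
    have := hG i
    rwa [← add_nsmul, Nat.sub_add_cancel (by omega)] at this
  · rw [map_sum, hsum]
    exact Finset.sum_congr rfl fun i _ => hG' i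

end

/-! ### Multiplicative polynomial functions of matrices -/

/-- A multiplicative polynomial function of one variable is a power. -/
theorem exists_eq_pow_of_mul {K : Type*} [Field K] [Infinite K] (ψ : K →* K) (p : Polynomial K)
    (hp : ∀ t, ψ t = p.eval t) : ∃ D : ℕ, ∀ t, ψ t = t ^ D := by
  have hne : p ≠ 0 := by
    rintro rfl
    simpa using hp 1
  obtain ⟨D, hD⟩ := Polynomial.support_nonempty.mpr hne
  refine ⟨D, fun t => ?_⟩
  -- As `p (t * X) = ψ t * p X`, compare the coefficients of `X ^ D`, where `p` has a nonzero one.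
  have h : p.comp (Polynomial.C t * Polynomial.X) = Polynomial.C (ψ t) * p := by
    refine Polynomial.funext fun s => ?_
    rw [Polynomial.eval_comp, Polynomial.eval_mul, Polynomial.eval_mul, Polynomial.eval_C,
      Polynomial.eval_X, Polynomial.eval_C, ← hp, ← hp, map_mul]
  have h2 := congrArg (fun q => Polynomial.coeff q D) h
  simp only [Polynomial.comp_C_mul_X_coeff, Polynomial.coeff_C_mul] at h2
  rw [mul_comm] at h2
  exact (mul_right_cancel₀ (Polynomial.mem_support_iff.mp hD) h2).symm

section
variable {K : Type*} [Field K] {n : Type*} [Fintype n] [DecidableEq n]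

/-- A transvection is a commutator with a diagonal matrix, so that every multiplicative function
takes the value `1` there. -/
theorem map_transvection_eq_one [Infinite K] (ψ : Matrix n n K →* K) {i j : n} (hij : i ≠ j)
    (c : K) :
    ψ (Matrix.transvection i j c) = 1 := by
  classical
  obtain ⟨a, ha⟩ := Infinite.exists_notMem_finset ({0, 1} : Finset K)
  have ha0 : a ≠ 0 := fun h => ha (by simp [h])
  have ha1 : a - 1 ≠ 0 := fun h => ha (by simp [sub_eq_zero.mp h])
  set b := c / (a - 1) with hb
  -- Conjugation by `diag (1, …, a, …, 1)` multiplies the parameter of the transvection by `a`, and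
  -- `c + b = a * b`.
  have hdiag : Matrix.diagonal (Function.update (1 : n → K) i a) * Matrix.transvection i j b =
      Matrix.transvection i j c * (Matrix.transvection i j b *
        Matrix.diagonal (Function.update (1 : n → K) i a)) := by
    rw [← mul_assoc, Matrix.transvection_mul_transvection_same _ _ hij]
    have hcb : c + b = a * b := by
      rw [hb]; field_simp; ring
    rw [hcb]
    ext x y
    rw [Matrix.diagonal_mul, Matrix.mul_diagonal]
    simp only [Matrix.transvection, Matrix.add_apply, Matrix.one_apply, Matrix.single_apply,
      Function.update_apply, Pi.one_apply]
    by_cases hx : x = i <;> by_cases hy : y = j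
    · subst hx; subst hy; simp [hij, hij.symm]
    · subst hx; by_cases hxy : x = y
      · subst hxy; simp [hij.symm]
      · simp [hxy, Ne.symm hxy, Ne.symm hy]
    · subst hy; by_cases hxy : x = y
      · subst hxy; simp [hx, Ne.symm hx]
      · simp [hxy, Ne.symm hx]
    · by_cases hxy : x = y
      · subst hxy; simp [hx, Ne.symm hx]
      · simp [hxy, Ne.symm hx, Ne.symm hy]
  have hunit : ∀ c, ψ (Matrix.transvection i j c) ≠ 0 := fun c h => by
    have h1 : ψ (Matrix.transvection i j c * Matrix.transvection i j (-c)) = 1 := by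
      rw [Matrix.transvection_mul_transvection_same _ _ hij]
      simp
    rw [map_mul, h, zero_mul] at h1
    exact zero_ne_one h1
  have hdu : ψ (Matrix.diagonal (Function.update (1 : n → K) i a)) ≠ 0 := fun h => by
    have h1 : ψ (Matrix.diagonal (Function.update (1 : n → K) i a) *
        Matrix.diagonal (Function.update (1 : n → K) i a⁻¹)) = 1 := by
      rw [Matrix.diagonal_mul_diagonal]
      rw [show (fun x => Function.update (1 : n → K) i a x * Function.update (1 : n → K) i a⁻¹ x)
        = 1 from ?_]
      · simp
      · funext x
        by_cases hx : x = i
        · subst hx; simp [ha0]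
        · simp [hx]
    rw [map_mul, h, zero_mul] at h1
    exact zero_ne_one h1
  have h := congrArg ψ hdiag
  rw [map_mul, map_mul, map_mul, mul_comm (ψ (Matrix.transvection i j b))] at h
  exact (mul_right_cancel₀ (mul_ne_zero hdu (hunit b)) ((one_mul _).trans h)).symm

/-- Conjugation by a permutation matrix moves the entries of a diagonal matrix. -/
theorem map_diagonal_update_eq (ψ : Matrix n n K →* K) (i j : n) (t : K) :
    ψ (Matrix.diagonal (Function.update (1 : n → K) i t)) =
      ψ (Matrix.diagonal (Function.update (1 : n → K) j t)) := by
  set P : Matrix n n K := (Equiv.swap i j).permMatrix K with hP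
  have hPP : P * P = 1 := by
    rw [hP, ← Matrix.permMatrix_mul]
    simp
  have h : P * Matrix.diagonal (Function.update (1 : n → K) i t) =
      Matrix.diagonal (Function.update (1 : n → K) j t) * P := by
    ext x y
    rw [Matrix.mul_diagonal, Matrix.diagonal_mul]
    simp only [hP, Equiv.Perm.permMatrix, Equiv.toPEquiv_apply, PEquiv.toMatrix_apply,
      Option.mem_some_iff]
    by_cases hxy : Equiv.swap i j x = y
    · rw [← hxy, Function.update_apply, Function.update_apply, mul_comm]
      simp [Equiv.swap_apply_eq_iff]
    · simp [hxy]
  have hu : ψ P ≠ 0 := fun h0 => by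
    have h1 := congrArg ψ hPP
    rw [map_mul, h0, zero_mul, map_one] at h1
    exact zero_ne_one h1
  have h2 := congrArg ψ h
  rw [map_mul, map_mul, mul_comm] at h2
  exact mul_right_cancel₀ hu h2

/-- A multiplicative polynomial function of square matrices is a power of the determinant. -/
theorem exists_eq_det_pow [Infinite K] (ψ : Matrix n n K →* K) (p : MvPolynomial (n × n) K)
    (hp : ∀ g, ψ g = MvPolynomial.eval (fun s => g s.1 s.2) p) :
    ∃ D : ℕ, (IsEmpty n → D = 0) ∧ ∀ g, ψ g = g.det ^ D := by
  rcases isEmpty_or_nonempty n with hn | ⟨⟨i⟩⟩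
  · exact ⟨0, fun _ => rfl, fun g => by rw [Subsingleton.elim g 1]; simp⟩
  have hone : Function.update (1 : n → K) i 1 = 1 := Function.update_eq_self i (1 : n → K)
  let r : K →* K :=
    { toFun := fun t => ψ (Matrix.diagonal (Function.update (1 : n → K) i t))
      map_one' := by simp [hone]
      map_mul' := fun s t => by
        rw [← map_mul, Matrix.diagonal_mul_diagonal]
        congr 2
        funext x
        by_cases hx : x = i
        · subst hx; simp
        · simp [hx] }
  obtain ⟨D, hD⟩ := exists_eq_pow_of_mul r
    (MvPolynomial.aeval (fun s : n × n =>
      Matrix.diagonal (Function.update (1 : n → Polynomial K) i Polynomial.X) s.1 s.2) p)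
    (fun t => by
      change ψ _ = _
      rw [hp, ← Polynomial.coe_aeval_eq_eval, ← AlgHom.coe_toRingHom, RingHom.coe_coe,
        ← AlgHom.comp_apply, MvPolynomial.comp_aeval, MvPolynomial.aeval_eq_eval]
      congr 2
      funext s
      by_cases h1 : s.1 = s.2
      · by_cases h2 : s.2 = i
        · simp [h1, h2]
        · simp [h1, h2]
      · simp [h1])
  refine ⟨D, fun h => (h.false i).elim, fun g => ?_⟩
  have hdiag : ∀ t : n → K, ψ (Matrix.diagonal t) = (∏ j, t j) ^ D := by
    intro t
    have h := MonoidHom.functions_ext K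
      (ψ.comp (Matrix.diagonalRingHom n K).toMonoidHom)
      { toFun := fun t => (∏ j, t j) ^ D
        map_one' := by simp
        map_mul' := fun s t => by simp [Finset.prod_mul_distrib, mul_pow] }
      (fun j x => by
        have h1 := map_diagonal_update_eq ψ j i x
        have h2 : (∏ l, Pi.mulSingle j x l) = x := by simp
        change ψ (Matrix.diagonal (Function.update 1 j x)) = (∏ l, Pi.mulSingle j x l) ^ D
        rw [h1, h2, ← hD]
        rfl)
    exact DFunLike.congr_fun h t
  have hlist : ∀ L : List (Matrix.TransvectionStruct n K),
      ψ ((L.map Matrix.TransvectionStruct.toMatrix).prod) = 1 := by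
    intro L
    induction L with
    | nil => simp
    | cons a L ih =>
      rw [List.map_cons, List.prod_cons, map_mul, ih, mul_one]
      exact map_transvection_eq_one ψ a.hij a.c
  obtain ⟨L, L', t, rfl⟩ := Matrix.Pivot.exists_list_transvec_mul_diagonal_mul_list_transvec g
  rw [map_mul, map_mul, hlist, hlist, hdiag, Matrix.det_mul, Matrix.det_mul,
    Matrix.TransvectionStruct.det_toMatrix_prod, Matrix.TransvectionStruct.det_toMatrix_prod,
    Matrix.det_diagonal]
  simp

/-- A multiplicative polynomial function of tuples of square matrices is a product of powers of
the determinants. -/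
theorem exists_eq_prod_det_pow [Infinite K] {k : ℕ} {d : Fin k → ℕ}
    (ψ : ((i : Fin k) → Matrix (Fin (d i)) (Fin (d i)) K) →* K)
    (p : MvPolynomial (MatVar d d) K) (hp : ∀ g, ψ g = evalMat g p) :
    ∃ D : Fin k → ℕ, (∀ i, d i = 0 → D i = 0) ∧ ∀ g, ψ g = ∏ i, (g i).det ^ D i := by
  have hblock : ∀ i, ∃ D : ℕ, (d i = 0 → D = 0) ∧ ∀ g, ψ (Pi.mulSingle i g) = g.det ^ D := by
    intro i
    obtain ⟨D, h0, hD⟩ := exists_eq_det_pow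
      (ψ.comp (MonoidHom.mulSingle (fun j => Matrix (Fin (d j)) (Fin (d j)) K) i))
      (evalMat (Pi.mulSingle (M := fun j => Matrix (Fin (d j)) (Fin (d j))
        (MvPolynomial (Fin (d i) × Fin (d i)) K)) i (Matrix.mvPolynomialX _ _ K)) p)
      (fun g => by
        change ψ (Pi.mulSingle i g) = _
        rw [hp, ← MvPolynomial.aeval_eq_eval, map_evalMat]
        congr 2
        funext l
        by_cases hl : l = i
        · subst hl
          ext a b
          simp [Matrix.mvPolynomialX]
        · ext a b
          simp [hl, Matrix.one_apply, apply_ite])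
    exact ⟨D, fun h => h0 (by rw [h]; infer_instance), hD⟩
  choose D h0 hD using hblock
  refine ⟨D, h0, fun g => ?_⟩
  have h : ψ = { toFun := fun g => ∏ i, (g i).det ^ D i
                 map_one' := by simp
                 map_mul' := fun s t => by simp [Finset.prod_mul_distrib, mul_pow] } := by
    refine MonoidHom.pi_ext fun i x => ?_
    rw [hD]
    change _ = ∏ l, (Pi.mulSingle (M := fun i => Matrix (Fin (d i)) (Fin (d i)) K) i x l).det ^ D l
    rw [Finset.prod_eq_single i]
    · simp
    · intro l _ hl
      simp [hl]
    · simp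
  exact DFunLike.congr_fun h g

end

/-! ### Factors of semi-invariants -/

theorem totalDegree_aeval_le_of_linear {K σ τ : Type*} [Field K] {φ : σ → MvPolynomial τ K}
    (hφ : ∀ s, (φ s).totalDegree ≤ 1) (f : MvPolynomial σ K) :
    (MvPolynomial.aeval φ f).totalDegree ≤ f.totalDegree := by
  rw [MvPolynomial.aeval_def, MvPolynomial.eval₂_eq]
  refine MvPolynomial.totalDegree_finsetSum_le fun e he => ?_
  refine (MvPolynomial.totalDegree_mul _ _).trans ?_
  rw [MvPolynomial.algebraMap_eq, MvPolynomial.totalDegree_C, zero_add]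
  refine (MvPolynomial.totalDegree_finsetProd _ _).trans ?_
  refine le_trans (Finset.sum_le_sum fun s _ => ?_) (MvPolynomial.le_totalDegree he)
  exact (MvPolynomial.totalDegree_pow _ _).trans (by simpa using Nat.mul_le_mul_left (e s) (hφ s))

section
variable {K : Type*} [Field K] {k : ℕ} {d m : Fin k → ℕ}

/-- The polynomial `A ↦ f (g * A)` in the entries of `A`. -/
noncomputable def leftMul (g : MatTuple K d d) :
    MvPolynomial (MatVar d m) K →ₐ[K] MvPolynomial (MatVar d m) K :=
  evalMat fun i =>
    ((g i).map MvPolynomial.C : Matrix (Fin (d i)) (Fin (d i)) (MvPolynomial (MatVar d m) K)) *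
      genericMat K d m i

theorem evalMat_leftMul (g : MatTuple K d d) (A : MatTuple K d m)
    (f : MvPolynomial (MatVar d m) K) :
    evalMat A (leftMul g f) = evalMat (fun i => g i * A i) f := by
  unfold leftMul
  rw [map_evalMat]
  congr 2
  funext i
  ext a j
  simp [Matrix.mul_apply, evalMat, genericMat]

theorem totalDegree_leftMul_le (g : MatTuple K d d) (f : MvPolynomial (MatVar d m) K) :
    (leftMul g f).totalDegree ≤ f.totalDegree := by
  refine totalDegree_aeval_le_of_linear (fun ⟨i, a, j⟩ => ?_) f
  refine (congrArg MvPolynomial.totalDegree Matrix.mul_apply).le.trans ?_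
  refine MvPolynomial.totalDegree_finsetSum_le fun b _ => ?_
  refine (MvPolynomial.totalDegree_mul _ _).trans ?_
  simp [genericMat]

/-- The polynomial `(g, A) ↦ f (g * A)`, as a polynomial in the entries of `g` whose coefficients
are polynomials in the entries of `A`. -/
noncomputable def genericLeftMul :
    MvPolynomial (MatVar d m) K →ₐ[K] MvPolynomial (MatVar d d) (MvPolynomial (MatVar d m) K) :=
  evalMat fun i => ((Matrix.of fun a b => MvPolynomial.X ⟨i, a, b⟩ :
      Matrix (Fin (d i)) (Fin (d i)) (MvPolynomial (MatVar d d) (MvPolynomial (MatVar d m) K))) *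
    ((genericMat K d m i).map MvPolynomial.C :
      Matrix (Fin (d i)) (Fin (m i)) (MvPolynomial (MatVar d d) (MvPolynomial (MatVar d m) K))))

theorem eval_genericLeftMul (g : MatTuple K d d) (f : MvPolynomial (MatVar d m) K) :
    MvPolynomial.eval (fun s : MatVar d d => MvPolynomial.C (g s.1 s.2.1 s.2.2))
      (genericLeftMul f) = leftMul g f := by
  have h := map_evalMat (K := K) ((MvPolynomial.aeval (R := MvPolynomial (MatVar d m) K)
    (fun s : MatVar d d => MvPolynomial.C (σ := MatVar d m)
      (g s.1 s.2.1 s.2.2))).restrictScalars K)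
    (fun i => ((Matrix.of fun a b => MvPolynomial.X ⟨i, a, b⟩ :
      Matrix (Fin (d i)) (Fin (d i)) (MvPolynomial (MatVar d d) (MvPolynomial (MatVar d m) K))) *
    ((genericMat K d m i).map MvPolynomial.C :
      Matrix (Fin (d i)) (Fin (m i)) (MvPolynomial (MatVar d d) (MvPolynomial (MatVar d m) K))))) f
  refine Eq.trans h ?_
  unfold leftMul
  congr 2
  funext i
  ext1 a j
  simp [Matrix.mul_apply]

theorem leftMul_one (f : MvPolynomial (MatVar d m) K) : leftMul (fun _ => 1) f = f := by
  have h : (fun i => ((1 : Matrix (Fin (d i)) (Fin (d i)) K).map MvPolynomial.C :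
      Matrix (Fin (d i)) (Fin (d i)) (MvPolynomial (MatVar d m) K)) * genericMat K d m i) =
      genericMat K d m := by
    funext i
    rw [Matrix.map_one _ (map_zero _) (map_one _), Matrix.one_mul]
  unfold leftMul
  rw [h]
  exact DFunLike.congr_fun (MvPolynomial.aeval_unique (AlgHom.id K _)).symm f

theorem genericLeftMul_pullback {F : MvPolynomial (PlVar d m) K} {D : Fin k → ℕ}
    (hF : IsMultihomogeneousOfDegree F D) :
    ∃ c, genericLeftMul (pullback K d m F) = c * MvPolynomial.C (pullback K d m F) := by
  unfold genericLeftMul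
  rw [evalMat_pullback, minorsOf_mul, aeval_smul hF fun i =>
    (Matrix.of fun a b => MvPolynomial.X (⟨i, a, b⟩ : MatVar d d)).det]
  refine ⟨_, congrArg _ ?_⟩
  have h := evalMat_pullback (K := K) (fun i => (genericMat K d m i).map
    (IsScalarTower.toAlgHom K (MvPolynomial (MatVar d m) K)
      (MvPolynomial (MatVar d d) (MvPolynomial (MatVar d m) K)))) F
  rw [← map_evalMat] at h
  refine Eq.trans h.symm ?_
  change MvPolynomial.C _ = _
  congr 1
  exact DFunLike.congr_fun (MvPolynomial.aeval_unique (AlgHom.id K _)).symm _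

/-- The group acts on the finite set of irreducible factors of a form in the minors, up to scalars;
as the group is connected, it acts trivially. In terms of polynomials: an irreducible factor `f`
divides `f (g * A)`, as a polynomial in the entries of `g` and `A`. -/
theorem dvd_leftMul_of_dvd_pullback {F : MvPolynomial (PlVar d m) K} (hF : IsMultihomogeneous F)
    (h0 : pullback K d m F ≠ 0) {f : MvPolynomial (MatVar d m) K} (hf : Irreducible f)
    (hdvd : f ∣ pullback K d m F) (g : MatTuple K d d) : f ∣ leftMul g f := by
  obtain ⟨D, hD⟩ := hF
  obtain ⟨c, hc⟩ := genericLeftMul_pullback hD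
  obtain ⟨b, hb, hfb⟩ := (FiniteMultiplicity.of_not_isUnit hf.not_isUnit
    h0).exists_eq_pow_mul_and_not_dvd
  have hprime : Prime (MvPolynomial.C f :
      MvPolynomial (MatVar d d) (MvPolynomial (MatVar d m) K)) :=
    (MvPolynomial.prime_C_iff _).mpr hf.prime
  have h1 : MvPolynomial.C f ∣ genericLeftMul (pullback K d m F) := by
    rw [hc]
    exact Dvd.dvd.mul_left (map_dvd _ hdvd) _
  have heval : ∀ p : MvPolynomial (MatVar d m) K, MvPolynomial.C f ∣ genericLeftMul p →
      ∀ g : MatTuple K d d, f ∣ leftMul g p := by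
    intro p hp g
    rw [← eval_genericLeftMul]
    simpa using map_dvd (MvPolynomial.eval
      (fun s : MatVar d d => MvPolynomial.C (σ := MatVar d m) (g s.1 s.2.1 s.2.2))) hp
  rw [hb, map_mul, map_pow] at h1
  rcases hprime.dvd_or_dvd h1 with h2 | h2
  · exact heval f (hprime.dvd_of_dvd_pow h2) g
  · have := heval b h2 fun _ => 1
    rw [leftMul_one] at this
    exact absurd this hfb

/-- For reasons of degree, the quotient of `f (g * A)` by `f (A)` is a constant in `A`; it is
multiplicative and polynomial in `g`, and hence a product of powers of determinants. -/
theorem isSemiInvariant_of_dvd_leftMul [Infinite K] {f : MvPolynomial (MatVar d m) K} (hf : f ≠ 0)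
    (h : ∀ g : MatTuple K d d, f ∣ leftMul g f) : ∃ D, IsSemiInvariant f D := by
  have hq : ∀ g : MatTuple K d d, ∃ q : K, leftMul g f = MvPolynomial.C q * f := by
    intro g
    obtain ⟨c, hc⟩ := h g
    by_cases hc0 : c = 0
    · exact ⟨0, by rw [hc, hc0]; simp⟩
    · have h1 := totalDegree_leftMul_le g f
      rw [hc, MvPolynomial.totalDegree_mul_of_isDomain hf hc0] at h1
      refine ⟨c.coeff 0, ?_⟩
      rw [hc, mul_comm, ← MvPolynomial.totalDegree_eq_zero_iff_eq_C.mp (by omega)]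
  choose q hq using hq
  have hval : ∀ (g : MatTuple K d d) (A : MatTuple K d m),
      evalMat (fun i => g i * A i) f = q g * evalMat A f := by
    intro g A
    rw [← evalMat_leftMul, hq, map_mul]
    simp [evalMat]
  obtain ⟨A, hA⟩ : ∃ A : MatTuple K d m, evalMat A f ≠ 0 := by
    by_contra! hA
    exact hf (evalMat_funext fun A => by rw [hA, map_zero])
  let ψ : ((i : Fin k) → Matrix (Fin (d i)) (Fin (d i)) K) →* K :=
    { toFun := q
      map_one' := by
        refine mul_right_cancel₀ hA ?_
        rw [← hval, one_mul]
        simp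
      map_mul' := fun g g' => by
        refine mul_right_cancel₀ hA ?_
        rw [mul_assoc, ← hval, ← hval, ← hval]
        simp [Matrix.mul_assoc] }
  obtain ⟨D, h0, hD⟩ := exists_eq_prod_det_pow ψ (MvPolynomial.C (evalMat A f)⁻¹ *
      evalMat (fun i => genericMat K d d i *
      ((A i).map MvPolynomial.C : Matrix (Fin (d i)) (Fin (m i)) (MvPolynomial (MatVar d d) K)))
        f) (fun g => by
    rw [map_mul, map_evalMat]
    have h1 : (fun i => (genericMat K d d i *
      ((A i).map MvPolynomial.C : Matrix (Fin (d i)) (Fin (m i)) (MvPolynomial (MatVar d d) K))).map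
        (evalMat g)) =
        fun i => g i * A i := by
      funext i
      ext a j
      simp [Matrix.mul_apply, evalMat, genericMat]
    rw [h1, hval]
    have h2 : evalMat g (MvPolynomial.C (evalMat A f)⁻¹) = (evalMat A f)⁻¹ := by simp [evalMat]
    rw [h2]
    change q g = _
    field_simp)
  exact ⟨D, h0, fun g A => by rw [hval, ← hD]; rfl⟩

end

/-! ### Points of the product of Grassmannians -/

section
variable {K : Type*} [Field K] {k : ℕ} {d m : Fin k → ℕ}

/-- Matrices whose row spaces are the components of `W`. -/
noncomputable def frame (W : GrProd K d m) : MatTuple K d m :=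
  fun i => basisMatrix (Module.finBasisOfFinrankEq K (W i).1 (W i).2)

/-- Whether a form vanishes at `W` can be tested on any matrices with row spaces `W i`. -/
theorem mem_zeroSet_iff_of_basis {F : MvPolynomial (PlVar d m) K} (hF : IsMultihomogeneous F)
    (W : GrProd K d m) (b : (i : Fin k) → Module.Basis (Fin (d i)) K (W i).1) :
    W ∈ zeroSet F ↔ evalMat (fun i => basisMatrix (b i)) (pullback K d m F) = 0 := by
  have h : multiPlucker W = fun i =>
      Projectivization.mk K (minors (basisMatrix (b i))) (minors_basisMatrix_ne_zero (b i)) :=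
    funext fun i => plucker_eq_mk (W i) (b i)
  change VanishesAt F (multiPlucker W) ↔ _
  rw [h, vanishesAt_iff hF, evalMat_pullback]
  rfl

theorem mem_zeroSet_iff {F : MvPolynomial (PlVar d m) K} (hF : IsMultihomogeneous F)
    (W : GrProd K d m) : W ∈ zeroSet F ↔ evalMat (frame W) (pullback K d m F) = 0 :=
  mem_zeroSet_iff_of_basis hF W _

theorem exists_minorsOf_frame_ne_zero (W : GrProd K d m) :
    ∃ I : (i : Fin k) → PluckerIndex (d i) (m i), ∀ i, minorsOf (frame W) ⟨i, I i⟩ ≠ 0 := by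
  have h : ∀ i, ∃ J : PluckerIndex (d i) (m i), minorsOf (frame W) ⟨i, J⟩ ≠ 0 := fun i =>
    Function.ne_iff.mp
      (minors_basisMatrix_ne_zero (Module.finBasisOfFinrankEq K (W i).1 (W i).2))
  choose I hI using h
  exact ⟨I, hI⟩

theorem nonempty_pluckerIndex (W : GrProd K d m) (i : Fin k) :
    Nonempty (PluckerIndex (d i) (m i)) :=
  ⟨(exists_minorsOf_frame_ne_zero W).choose i⟩

/-- Every tuple of matrices with a nonzero maximal minor in each factor represents a point of the
product of Grassmannians, the tuple of the row spaces. -/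
theorem exists_mem_zeroSet_iff (A : MatTuple K d m) (I : (i : Fin k) → PluckerIndex (d i) (m i))
    (hA : ∀ i, minorsOf A ⟨i, I i⟩ ≠ 0) :
    ∃ W : GrProd K d m, ∀ F : MvPolynomial (PlVar d m) K, IsMultihomogeneous F →
      (W ∈ zeroSet F ↔ evalMat A (pullback K d m F) = 0) := by
  have hli : ∀ i, LinearIndependent K (A i).row := by
    intro i
    have h1 : LinearIndependent K ((A i).submatrix id (I i)).row := by
      rw [Matrix.linearIndependent_rows_iff_isUnit, Matrix.isUnit_iff_isUnit_det]
      exact (hA i).isUnit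
    exact LinearIndependent.of_comp (LinearMap.funLeft K K (I i)) h1
  let W : GrProd K d m := fun i => ⟨Submodule.span K (Set.range (A i).row), by
    rw [finrank_span_eq_card (hli i), Fintype.card_fin]⟩
  let b : (i : Fin k) → Module.Basis (Fin (d i)) K (W i).1 := fun i => Module.Basis.span (hli i)
  have h : (fun i => basisMatrix (b i)) = A := by
    funext i
    ext a j
    change ((Module.Basis.span (hli i) a : Submodule.span K (Set.range (A i).row)) :
      Fin (m i) → K) j = _
    rw [Module.Basis.span_apply]
    rfl
  refine ⟨W, fun F hF => ?_⟩
  rw [mem_zeroSet_iff_of_basis hF W b, h]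

/-- The closed subsets of the product of Grassmannians are the common zero sets of forms. -/
theorem isClosed_iff {Z : Set (GrProd K d m)} :
    IsClosed Z ↔ ∃ S : Set (MvPolynomial (PlVar d m) K), (∀ F ∈ S, IsMultihomogeneous F) ∧
      Z = {W | ∀ F ∈ S, W ∈ zeroSet F} := by
  have h : ∀ T : Set (MultiProj K fun i => PluckerIndex (d i) (m i)), IsClosed T ↔
      ∃ S : Set (MvPolynomial (PlVar d m) K), (∀ F ∈ S, IsMultihomogeneous F) ∧
        T = zeroLocus S := by
    intro T
    rw [← isOpen_compl_iff]
    change Tᶜᶜ ∈ _ ↔ _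
    rw [compl_compl]
    rfl
  rw [isClosed_induced_iff]
  constructor
  · rintro ⟨T, hT, rfl⟩
    obtain ⟨S, hS, rfl⟩ := (h T).mp hT
    exact ⟨S, hS, rfl⟩
  · rintro ⟨S, hS, rfl⟩
    exact ⟨zeroLocus S, (h _).mpr ⟨S, hS, rfl⟩, rfl⟩

theorem isClosed_zeroSet {F : MvPolynomial (PlVar d m) K} (hF : IsMultihomogeneous F) :
    IsClosed (zeroSet F : Set (GrProd K d m)) :=
  isClosed_iff.mpr ⟨{F}, by simpa using hF, by ext W; simp⟩

theorem exists_form_of_not_subset {Y Z : Set (GrProd K d m)} (hZ : IsClosed Z) (h : ¬ Y ⊆ Z) :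
    ∃ F : MvPolynomial (PlVar d m) K, IsMultihomogeneous F ∧ Z ⊆ zeroSet F ∧ ¬ Y ⊆ zeroSet F := by
  obtain ⟨S, hS, rfl⟩ := isClosed_iff.mp hZ
  obtain ⟨W, hW, hWZ⟩ := Set.not_subset.mp h
  simp only [Set.mem_ofPred_eq, not_forall] at hWZ
  obtain ⟨F, hF, hWF⟩ := hWZ
  exact ⟨F, hS F hF, fun W' hW' => hW' F hF, fun h => hWF (h hW)⟩

theorem zeroSet_mul (F G : MvPolynomial (PlVar d m) K) :
    (zeroSet (F * G) : Set (GrProd K d m)) = zeroSet F ∪ zeroSet G := by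
  ext W
  simp [zeroSet, VanishesAt]

theorem zeroSet_prod {ι : Type*} (s : Finset ι) (F : ι → MvPolynomial (PlVar d m) K) :
    (zeroSet (∏ j ∈ s, F j) : Set (GrProd K d m)) = ⋃ j ∈ s, zeroSet (F j) := by
  ext W
  simp [zeroSet, VanishesAt, Finset.prod_eq_zero_iff]

theorem IsMultihomogeneous.mul {F G : MvPolynomial (PlVar d m) K} (hF : IsMultihomogeneous F)
    (hG : IsMultihomogeneous G) : IsMultihomogeneous (F * G) := by
  obtain ⟨D, hD⟩ := hF
  obtain ⟨E, hE⟩ := hG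
  exact ⟨D + E, MvPolynomial.IsWeightedHomogeneous.mul hD hE⟩

theorem IsMultihomogeneous.prod {ι : Type*} (s : Finset ι) {F : ι → MvPolynomial (PlVar d m) K}
    (hF : ∀ j ∈ s, IsMultihomogeneous (F j)) : IsMultihomogeneous (∏ j ∈ s, F j) := by
  choose! D hD using hF
  exact ⟨∑ j ∈ s, D j, MvPolynomial.IsWeightedHomogeneous.prod _ _ _ hD⟩

/-! ### Irreducible closed sets -/

/-- Let `f` be zero or a prime element, given by its properties: it divides one of the factors of
a product which it divides, and every polynomial which vanishes on the zero set of `f`. Then the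
zero set of `f` in the product of Grassmannians is irreducible, unless it is empty. -/
theorem isIrreducible_zeroSet {f : MvPolynomial (MatVar d m) K}
    (hdvd : ∀ a b, f ∣ a * b → f ∣ a ∨ f ∣ b)
    (hnull : ∀ h, (∀ A : MatTuple K d m, evalMat A f = 0 → evalMat A h = 0) → f ∣ h)
    {F : MvPolynomial (PlVar d m) K} (hF : IsMultihomogeneous F) {r : ℕ} (hr : r ≠ 0)
    (hFf : pullback K d m F = f ^ r) (hne : (zeroSet F : Set (GrProd K d m)).Nonempty) :
    IsIrreducible (zeroSet F : Set (GrProd K d m)) := by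
  have hmem : ∀ W : GrProd K d m, W ∈ zeroSet F ↔ evalMat (frame W) f = 0 := fun W => by
    rw [mem_zeroSet_iff hF, hFf, map_pow, pow_eq_zero_iff hr]
  have hsub : ∀ H : MvPolynomial (PlVar d m) K, IsMultihomogeneous H → f ∣ pullback K d m H →
      (zeroSet F : Set (GrProd K d m)) ⊆ zeroSet H := fun H hH ⟨c, hc⟩ W hW => by
    rw [mem_zeroSet_iff hH, hc, map_mul, (hmem W).mp hW, zero_mul]
  refine ⟨hne, isPreirreducible_iff_isClosed_union_isClosed.mpr fun Z₁ Z₂ h₁ h₂ h => ?_⟩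
  by_contra! hc
  obtain ⟨F₁, hF₁, hZ₁, hn₁⟩ := exists_form_of_not_subset h₁ hc.1
  obtain ⟨F₂, hF₂, hZ₂, hn₂⟩ := exists_form_of_not_subset h₂ hc.2
  obtain ⟨W, hW⟩ := hne
  obtain ⟨I, hI⟩ := exists_minorsOf_frame_ne_zero W
  set p : MvPolynomial (MatVar d m) K :=
    pullback K d m (∏ i, MvPolynomial.X ⟨i, I i⟩) with hp
  have hpA : ∀ A : MatTuple K d m, evalMat A p = ∏ i, minorsOf A ⟨i, I i⟩ := fun A => by
    rw [hp, evalMat_pullback]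
    simp
  -- A zero of `f` at which `p` does not vanish represents a point of `zeroSet F`, where `F₁ * F₂`
  -- vanishes.
  have hd : f ∣ pullback K d m (F₁ * F₂) * p := by
    refine hnull _ fun A hA => ?_
    rw [map_mul, mul_eq_zero, hpA, or_iff_not_imp_right]
    intro hA0
    obtain ⟨W', hW'⟩ := exists_mem_zeroSet_iff A I
      fun i => Finset.prod_ne_zero_iff.mp hA0 i (Finset.mem_univ i)
    rw [← hW' _ (hF₁.mul hF₂), zeroSet_mul]
    have : W' ∈ zeroSet F := by
      rw [hW' F hF, hFf, map_pow, hA, zero_pow hr]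
    exact Set.union_subset_union hZ₁ hZ₂ (h this)
  rcases hdvd _ _ hd with hd | ⟨c, hc⟩
  · rw [map_mul] at hd
    rcases hdvd _ _ hd with hd | hd
    · exact hn₁ (hsub F₁ hF₁ hd)
    · exact hn₂ (hsub F₂ hF₂ hd)
  · have h1 := hpA (frame W)
    rw [hc, map_mul, (hmem W).mp hW, zero_mul] at h1
    exact Finset.prod_ne_zero_iff.mpr (fun i _ => hI i) h1.symm

/-- The product of Grassmannians is irreducible: it is the zero set of `f = 0`. -/
theorem isIrreducible_univ [Infinite K] [Nonempty (GrProd K d m)] :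
    IsIrreducible (Set.univ : Set (GrProd K d m)) := by
  have h0 : (zeroSet (0 : MvPolynomial (PlVar d m) K) : Set (GrProd K d m)) = Set.univ := by
    ext W
    simp [zeroSet, VanishesAt]
  rw [← h0]
  refine isIrreducible_zeroSet (f := 0) (by simp) (fun h hh => ?_)
    ⟨0, MvPolynomial.isWeightedHomogeneous_zero _ _ _⟩ one_ne_zero (by simp)
    (by rw [h0]; exact Set.univ_nonempty)
  rw [zero_dvd_iff]
  exact evalMat_funext fun A => by rw [hh A (map_zero _), map_zero]

/-- For a prime element `f`, the divisibility of the polynomials vanishing on its zero set is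
Hilbert's Nullstellensatz. -/
theorem isIrreducible_zeroSet_of_prime [IsAlgClosed K] {f : MvPolynomial (MatVar d m) K}
    (hf : Prime f) {F : MvPolynomial (PlVar d m) K} (hF : IsMultihomogeneous F) {r : ℕ}
    (hr : r ≠ 0) (hFf : pullback K d m F = f ^ r)
    (hne : (zeroSet F : Set (GrProd K d m)).Nonempty) :
    IsIrreducible (zeroSet F : Set (GrProd K d m)) := by
  refine isIrreducible_zeroSet (fun _ _ => hf.dvd_or_dvd) (fun h hh => ?_) hF hr hFf hne
  have hP : (Ideal.span {f}).IsPrime := (Ideal.span_singleton_prime hf.ne_zero).mpr hf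
  rw [← Ideal.mem_span_singleton, ← MvPolynomial.IsPrime.vanishingIdeal_zeroLocus (K := K)
    (Ideal.span {f}), MvPolynomial.mem_vanishingIdeal_iff]
  intro x hx
  exact hh (fun i => Matrix.of fun a j => x ⟨i, a, j⟩)
    (MvPolynomial.mem_zeroLocus_iff.mp hx f (Ideal.mem_span_singleton_self f))

end

/-! ### Irreducible components and hypersurfaces -/

/-- Every point of a closed set lies in an irreducible component of this set. -/
theorem exists_maximal_irreducibleCloseds {X : Type*} [TopologicalSpace X] {Z : Set X}
    (hZ : IsClosed Z) {x : X} (hx : x ∈ Z) : ∃ C : TopologicalSpace.IrreducibleCloseds X, x ∈ C ∧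
      Maximal (fun C' : TopologicalSpace.IrreducibleCloseds X => (C' : Set X) ⊆ Z) C := by
  set z : Z := ⟨x, hx⟩
  set T : Set X := Subtype.val '' irreducibleComponent z
  have hTi : IsIrreducible T :=
    isIrreducible_irreducibleComponent.image _ continuous_subtype_val.continuousOn
  have hTc : IsClosed T := hZ.isClosedMap_subtype_val _ isClosed_irreducibleComponent
  refine ⟨⟨T, hTi, hTc⟩, ⟨z, mem_irreducibleComponent, rfl⟩, ?_, ?_⟩
  · rintro _ ⟨y, -, rfl⟩
    exact y.2
  · intro C hC hle
    have hC' : (Subtype.val '' (Subtype.val ⁻¹' (C : Set X) : Set Z)) = (C : Set X) := by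
      rw [Subtype.image_preimage_coe, Set.inter_eq_right.mpr hC]
    have hpre : IsIrreducible (Subtype.val ⁻¹' (C : Set X) : Set Z) := by
      refine ⟨⟨z, hle ⟨z, mem_irreducibleComponent, rfl⟩⟩,
        isPreirreducible_iff_isClosed_union_isClosed.mpr fun z₁ z₂ h₁ h₂ h => ?_⟩
      have h3 := isPreirreducible_iff_isClosed_union_isClosed.mp C.isIrreducible'.2 _ _
        (hZ.isClosedMap_subtype_val _ h₁) (hZ.isClosedMap_subtype_val _ h₂) (by
          change (C : Set X) ⊆ _
          rw [← hC', ← Set.image_union]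
          exact Set.image_mono h)
      refine h3.imp (fun h4 y hy => ?_) fun h4 y hy => ?_ <;>
      · obtain ⟨y', hy', hyy⟩ := h4 hy
        rwa [← Subtype.ext hyy]
    have heq := eq_irreducibleComponent hpre.2 (x := z) (by
      intro y hy
      exact hle ⟨y, hy, rfl⟩)
    change (C : Set X) ⊆ T
    rw [← hC', heq]

/-- An irreducible closed set of codimension one is not properly contained in a proper
irreducible closed set. -/
theorem eq_of_coheight_eq_one {X : Type*} [TopologicalSpace X]
    {C C' T : TopologicalSpace.IrreducibleCloseds X} (hC : Order.coheight C = 1) (h : C ≤ C')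
    (hT : C' < T) : C = C' := by
  by_contra hne
  have h1 := Order.coheight_add_one_le hT
  have h2 := Order.coheight_add_one_le (lt_of_le_of_ne h hne)
  rw [hC] at h2
  have h3 : (1 : ℕ∞) + 1 ≤ 1 := le_trans (by gcongr; exact le_trans (by simp) h1) h2
  exact absurd h3 (by decide)

/-- Let `F₀` be a form which vanishes on the hypersurface `Z`, but not identically. Each irreducible
component of `Z` is contained in, and hence equal to, the irreducible closed set defined by an
irreducible factor of the pullback of `F₀`. -/
theorem exists_eq_zeroSet_of_isHypersurface {K : Type*} [Field K] [IsAlgClosed K] {k : ℕ}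
    (d m : Fin k → ℕ) (Z : Set (GrProd K d m)) (hZ : IsHypersurface Z) :
    ∃ F : MvPolynomial (PlVar d m) K, IsMultihomogeneous F ∧ Z = zeroSet F := by
  classical
  have : Infinite K := IsAlgClosed.instInfinite
  obtain ⟨hZc, hZ1⟩ := hZ
  rcases isEmpty_or_nonempty (GrProd K d m) with hE | hN
  · exact ⟨0, ⟨0, MvPolynomial.isWeightedHomogeneous_zero _ _ _⟩, Subsingleton.elim _ _⟩
  set T : TopologicalSpace.IrreducibleCloseds (GrProd K d m) :=
    ⟨Set.univ, isIrreducible_univ, isClosed_univ⟩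
  have hTmax : IsMax T := fun C _ => Set.subset_univ (C : Set (GrProd K d m))
  have hZT : ¬ Set.univ ⊆ Z := fun h => by
    have h1 := hZ1 T ⟨h, fun C _ (hC : T ≤ C) => hTmax hC⟩
    rw [Order.coheight_eq_zero.mpr hTmax] at h1
    exact zero_ne_one h1
  obtain ⟨F₀, hF₀, hZF₀, hF₀ne⟩ := exists_form_of_not_subset hZc hZT
  have h0 : pullback K d m F₀ ≠ 0 := fun h => hF₀ne fun W _ => by
    rw [mem_zeroSet_iff hF₀, h, map_zero]
  have hne := nonempty_pluckerIndex hN.some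
  -- the irreducible factors `f` of the pullback of `F₀`, and forms defining their zero sets
  set s := (UniqueFactorizationMonoid.factors (pullback K d m F₀)).toFinset
  have hirr : ∀ f ∈ s, Irreducible f := fun f hf =>
    UniqueFactorizationMonoid.irreducible_of_factor f (Multiset.mem_toFinset.mp hf)
  have hform : ∀ f ∈ s, ∃ (r : ℕ) (F : MvPolynomial (PlVar d m) K), r ≠ 0 ∧
      IsMultihomogeneous F ∧ pullback K d m F = f ^ r := by
    intro f hf
    obtain ⟨D, hD⟩ := isSemiInvariant_of_dvd_leftMul (hirr f hf).ne_zero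
      (dvd_leftMul_of_dvd_pullback hF₀ h0 (hirr f hf)
        (UniqueFactorizationMonoid.dvd_of_mem_factors (Multiset.mem_toFinset.mp hf)))
    exact hD.exists_pullback_eq_pow hne
  choose! r F hr hF hFf using hform
  have hmem : ∀ f ∈ s, ∀ W : GrProd K d m, W ∈ zeroSet (F f) ↔ evalMat (frame W) f = 0 :=
    fun f hf W => by rw [mem_zeroSet_iff (hF f hf), hFf f hf, map_pow, pow_eq_zero_iff (hr f hf)]
  have hcover : Z ⊆ ⋃₀ ↑(s.image fun f => (zeroSet (F f) : Set (GrProd K d m))) := by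
    intro W hW
    have h1 := (mem_zeroSet_iff hF₀ W).mp (hZF₀ hW)
    obtain ⟨c, hc⟩ := (UniqueFactorizationMonoid.factors_prod h0).symm.dvd
    have h2 := congrArg (evalMat (frame W)) hc
    rw [map_mul, h1, zero_mul, map_multiset_prod, Multiset.prod_eq_zero_iff,
      Multiset.mem_map] at h2
    obtain ⟨f, hf, hfW⟩ := h2
    have hfs := Multiset.mem_toFinset.mpr hf
    exact ⟨zeroSet (F f), Finset.mem_coe.mpr (Finset.mem_image_of_mem _ hfs),
      (hmem f hfs W).mpr hfW⟩
  refine ⟨∏ f ∈ s with zeroSet (F f) ⊆ Z, F f, IsMultihomogeneous.prod _ fun f hf =>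
    hF f (Finset.mem_filter.mp hf).1, ?_⟩
  rw [zeroSet_prod]
  apply Set.Subset.antisymm
  · intro W hW
    obtain ⟨C, hWC, hC⟩ := exists_maximal_irreducibleCloseds hZc hW
    obtain ⟨_, hz, hCz⟩ := isIrreducible_iff_sUnion_isClosed.mp C.isIrreducible'
      (s.image fun f => (zeroSet (F f) : Set (GrProd K d m)))
      (fun z hz => by
        obtain ⟨f, hf, rfl⟩ := Finset.mem_image.mp hz
        exact isClosed_zeroSet (hF f hf))
      (hC.1.trans hcover)
    obtain ⟨f, hf, rfl⟩ := Finset.mem_image.mp hz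
    set C' : TopologicalSpace.IrreducibleCloseds (GrProd K d m) :=
      ⟨zeroSet (F f), isIrreducible_zeroSet_of_prime (hirr f hf).prime (hF f hf) (hr f hf)
        (hFf f hf) ⟨W, hCz hWC⟩, isClosed_zeroSet (hF f hf)⟩
    have hlt : C' < T := by
      refine lt_of_le_of_ne (Set.subset_univ _) fun h => ?_
      refine hF₀ne fun V _ => ?_
      have hV : V ∈ C' := h ▸ Set.mem_univ V
      obtain ⟨c, hc⟩ := UniqueFactorizationMonoid.dvd_of_mem_factors (Multiset.mem_toFinset.mp hf)
      rw [mem_zeroSet_iff hF₀, hc, map_mul, (hmem f hf V).mp hV, zero_mul]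
    have heq : C = C' := eq_of_coheight_eq_one (hZ1 C hC) hCz hlt
    have hsub : (zeroSet (F f) : Set (GrProd K d m)) ⊆ Z := by
      have := hC.1
      rwa [heq] at this
    exact Set.mem_biUnion (Finset.mem_filter.mpr ⟨hf, hsub⟩) (hCz hWC)
  · exact Set.iUnion₂_subset fun f hf => (Finset.mem_filter.mp hf).2

end MultiPlucker

theorem mainTheorem8 {K : Type*} [Field K] [IsAlgClosed K] {k : ℕ} (d m : Fin k → ℕ)
    (Z : Set (MultiPlucker.GrProd K d m)) (hZ : MultiPlucker.IsHypersurface Z) :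
    ∃ F : MvPolynomial (Σ i, MultiPlucker.PluckerIndex (d i) (m i)) K,
      MultiPlucker.IsMultihomogeneous F ∧ Z = MultiPlucker.zeroSet F :=
  MultiPlucker.exists_eq_zeroSet_of_isHypersurface d m Z hZ
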